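/- **Lemma (universal centralizer $\simeq T^*\Sigma$).** Let $\mathfrak g$ be a finite-dimensional complex reductive Lie algebra with a nondegenerate invariant symmetric bilinear form $\kappa$ (for semisimple $\mathfrak g$ one may take the Killing form). Let $(e,h,f)$ be a principal $\mathfrak{sl}_2$-triple in $\mathfrak g$: $[e,f]=h$, $[h,e]=2e$, $[h,f]=-2f$, with $e$ regular (its centralizer has the minimal dimension). Identify $\mathfrak g\simeq\mathfrak g^*$ by $\kappa$, let $\Sigma\subset\mathfrak g^*$ be the Kostant slice, i.e. the image of $e+\mathfrak z(f)$, and let $$\mathfrak Z=\{(x,\xi)\in\mathfrak g\times\Sigma:\ \mathrm{ad}_x\xi=0\}$$ be the universal centralizer ($\mathrm{ad}_x\xi$ is the coadjoint action), with fibre $\mathfrak z(\xi)$ over $\xi\in\Sigma$. Then $\mathfrak Z$ is canonically isomorphic to the cotangent bundle $T^*\Sigma$: the map $$\Phi:\mathfrak Z\to T^*\Sigma,\qquad (x,\xi)\mapsto\bigl(\xi,\ x|_{T_\xi\Sigma}\bigr),$$ where $x\in\mathfrak g=(\mathfrak g^*)^*$ is viewed as a linear functional on $\mathfrak g^*$ and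 restricted to the subspace $T_\xi\Sigma\subset\mathfrak g^*$, is an isomorphism of algebraic varieties over $\Sigma$ which is linear on the fibres. Moreover, let $G$ be a connected reductive algebraic group with Lie algebra $\mathfrak g$. For every $P\in\mathbb C[\mathfrak g^*]^{G}$ the differential $\xi\mapsto dP(\xi)\in(\mathfrak g^*)^*=\mathfrak g$, restricted to $\Sigma$, is a regular section of $\mathfrak Z\to\Sigma$, and $\Phi$ identifies it with the section $d(P|_\Sigma)$ of $T^*\Sigma$. -/

import Mathlib

noncomputable section

namespace KostantSlice

open Module

section Varieties

variable {V W : Type*} [AddCommGroup V] [Module ℂ V] [AddCommGroup W] [Module ℂ W]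

/-- The algebra `ℂ[V]` of polynomial functions on a (finite-dimensional) complex vector space `V`:
the subalgebra of all functions `V → ℂ` generated by the linear functionals. -/
def polynomialFunctions (V : Type*) [AddCommGroup V] [Module ℂ V] : Subalgebra ℂ (V → ℂ) :=
  Algebra.adjoin ℂ (Set.range fun (φ : Dual ℂ V) => (φ : V → ℂ))

/-- A map between subsets of two vector spaces is regular if each linear coordinate of it is the
restriction of a polynomial function of the ambient space. On algebraic subsets these are
the morphisms of affine varieties. -/
def IsRegularMap {S : Set V} {T : Set W} (φ : S → T) : Prop :=
  ∀ l : Dual ℂ W, ∃ p ∈ polynomialFunctions V, ∀ s : S, l (φ s : W) = p s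

/-- The cotangent bundle `T^*S` of an affine subspace `S` of `V`, as a subvariety of
`V × (T S)^*`. All tangent spaces of `S` are the direction of `S`, so that a point of
`T^*S` is a point of `S` together with a linear functional on the direction. -/
def cotangentBundle (S : AffineSubspace ℂ V) : Set (V × Dual ℂ S.direction) :=
  {p | p.1 ∈ S}

/-- The covector `α ∈ T_s^*S` is the differential at `s` of the function `F` on the
affine subspace `S`. -/
def HasDifferentialAt (S : AffineSubspace ℂ V) (F : ↥(S : Set V) → ℂ) (s : ↥(S : Set V))
    (α : Dual ℂ S.direction) : Prop :=
  ∀ v : S.direction, HasDerivAt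
    (fun t : ℂ => F ⟨((t • v : S.direction) : V) +ᵥ (s : V),
      AffineSubspace.vadd_mem_of_mem_direction (t • v).2 s.2⟩) (α v) 0

end Varieties

variable {g : Type*} [LieRing g] [LieAlgebra ℂ g]

/-- A Lie algebra is reductive if its radical is its center. -/
def IsReductive (g : Type*) [LieRing g] [LieAlgebra ℂ g] : Prop :=
  LieAlgebra.radical ℂ g = LieAlgebra.center ℂ g

/-- A principal `sl₂`-triple `(e, h, f)`: the relations of `sl₂` hold and `e` is regular, that is,
its centralizer has the minimal dimension among the centralizers of elements of `g`.
(All three elements vanish if `g` is abelian, and only then.) -/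
structure IsPrincipalTriple (h e f : g) : Prop where
  lie_e_f : ⁅e, f⁆ = h
  lie_h_e : ⁅h, e⁆ = (2 : ℂ) • e
  lie_h_f : ⁅h, f⁆ = -((2 : ℂ) • f)
  regular : ∀ y : g, finrank ℂ (LieAlgebra.ad ℂ g e).ker ≤ finrank ℂ (LieAlgebra.ad ℂ g y).ker

/-- The Kostant slice `Σ = e + 𝔷(f)`, carried into `g^*` by the form `κ`. -/
def kostantSlice (κ : LinearMap.BilinForm ℂ g) (e f : g) : AffineSubspace ℂ (Dual ℂ g) :=
  AffineSubspace.mk' (κ e) ((LieAlgebra.ad ℂ g f).ker.map κ)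

/-- The universal centralizer `{(x, ξ) : x ∈ g, ξ ∈ Σ, ad_x ξ = 0}` over a subset of `g^*`;
the bracket `⁅x, ξ⁆` is the coadjoint action of `g` on `g^*`. -/
def universalCentralizer (S : AffineSubspace ℂ (Dual ℂ g)) : Set (g × Dual ℂ g) :=
  {p | p.2 ∈ S ∧ ⁅p.1, p.2⁆ = 0}

/-- The exponential `∑ N^k / k!` of a nilpotent endomorphism `N`. -/
def nilpotentExp (N : End ℂ g) : End ℂ g :=
  ∑ k ∈ Finset.range (nilpotencyClass N), ((k.factorial : ℂ)⁻¹) • N ^ k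

/-- The adjoint group of a reductive Lie algebra, that is, the image under `Ad` of any connected
algebraic group with Lie algebra `g`: the subgroup of `GL(g)` generated by
the `exp (ad x)` with `ad x` nilpotent. -/
def adjointGroup (g : Type*) [LieRing g] [LieAlgebra ℂ g] : Subgroup (g ≃ₗ[ℂ] g) :=
  Subgroup.closure {a | ∃ x : g, IsNilpotent (LieAlgebra.ad ℂ g x) ∧
    (a : g →ₗ[ℂ] g) = nilpotentExp (LieAlgebra.ad ℂ g x)}

/-- `P ∈ ℂ[g^*]^G`: a polynomial function on `g^*` invariant under the coadjoint action
`ξ ↦ ξ ∘ a⁻¹`. -/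
def IsInvariantPolynomial (P : Dual ℂ g → ℂ) : Prop :=
  P ∈ polynomialFunctions (Dual ℂ g) ∧
    ∀ a ∈ adjointGroup g, ∀ ξ : Dual ℂ g, P (ξ ∘ₗ ((a⁻¹ : g ≃ₗ[ℂ] g) : g →ₗ[ℂ] g)) = P ξ

/-- The element `x` of `g = (g^*)^*` is the differential at `ξ` of the function `P` on `g^*`. -/
def IsDifferentialAt (P : Dual ℂ g → ℂ) (ξ : Dual ℂ g) (x : g) : Prop :=
  ∀ η : Dual ℂ g, HasLineDerivAt ℂ P (η x) ξ η

end KostantSlice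

end

open Module KostantSlice

open Module KostantSlice

/-! Everything is moved to `g` by `κ`: a point of the slice is `e + u` with `u ∈ 𝔷(f)`, and tangent
vectors are the elements of `𝔷(f)`. Over the base point, the map `Φ` is the pairing of `𝔷(e)` with
`𝔷(f)`. It is perfect because `g = 𝔷(f) ⊕ [e, g] = 𝔷(e) ⊕ [f, g]` and `[x, g]` is orthogonal to
`𝔷(x)`.

The other fibres are compared with this one (`exists_sliceInverse`). Let `s` be a partial inverse of
`ad e`, with values in `[f, g]` and zero on `𝔷(f)`. As `ad u` commutes with `ad f`, it preserves the
filtration by `ker (ad f)^k`, which `s` lowers. Hence `s ad u` is nilpotent and `1 + s ad u` has an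
inverse polynomial in `u`. It maps `𝔷(e + u)` injectively to `𝔷(e)`, and onto it because `e` is
regular. It moves elements only within `[f, g]`, which is orthogonal to `𝔷(f)`, so the functional on
the tangent space is unchanged. Thus `Φ⁻¹` is a representing element of `𝔷(e)` followed by a
polynomial operator.

For invariant `P`, let `x = dP` at `e + u`. Differentiating along `exp (t ad n)` makes `[e + u, x]`
orthogonal to all ad-nilpotent `n`, hence central by reductivity (`mem_center_of_orthogonal`). It
then lies in `𝔷(f)`, and it vanishes because orbits are transversal to the slice
(`eq_zero_of_lie_slice`). -/

namespace KostantSlice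

/-! ### Representations of `sl₂`, without complete reducibility. -/

section LinearAlgebra

variable {V : Type*} [AddCommGroup V] [Module ℂ V]

/-- A nonzero subspace stable under an endomorphism of a finite-dimensional complex vector space
contains an eigenvector. -/
lemma exists_eigenvector_mem [FiniteDimensional ℂ V] (T : End ℂ V) (S : Submodule ℂ V) (hS : S ≠ ⊥)
    (hT : ∀ x ∈ S, T x ∈ S) : ∃ v ∈ S, v ≠ 0 ∧ ∃ μ : ℂ, T v = μ • v := by
  have : Nontrivial S := Submodule.nontrivial_iff_ne_bot.mpr hS
  obtain ⟨μ, hμ⟩ := Module.End.exists_eigenvalue (T.restrict hT)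
  obtain ⟨v, hv⟩ := hμ.exists_hasEigenvector
  refine ⟨v, v.2, by simpa using hv.2, μ, ?_⟩
  simpa using congrArg Subtype.val hv.apply_eq_smul

/-- If `[H, F] = c F` with `c ≠ 0` then `F` is nilpotent. -/
lemma isNilpotent_of_commutator_eq_smul [FiniteDimensional ℂ V] (H F : End ℂ V) (c : ℂ) (hc : c ≠ 0)
    (hF : H * F - F * H = c • F) : IsNilpotent F := by
  have key : ∀ n : ℕ, H * F ^ n - F ^ n * H = ((n : ℂ) * c) • F ^ n := by
    intro n
    induction n with
    | zero => simp
    | succ n ih =>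
      have : H * F ^ (n + 1) - F ^ (n + 1) * H
          = (H * F ^ n - F ^ n * H) * F + F ^ n * (H * F - F * H) := by
        rw [pow_succ]; noncomm_ring
      rw [this, ih, hF, pow_succ]
      simp only [smul_mul_assoc, mul_smul_comm, ← add_smul]
      push_cast
      ring_nf
  by_contra hnil
  have hne : ∀ n, F ^ n ≠ 0 := fun n hn => hnil ⟨n, hn⟩
  -- Nonzero powers of `F` would be eigenvectors of `[H, ·]` with the distinct eigenvalues `n c`, so
  -- infinitely many independent vectors in `End V`.
  let D : End ℂ (End ℂ V) := LinearMap.mulLeft ℂ H - LinearMap.mulRight ℂ H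
  have hli : LinearIndependent ℂ fun n : ℕ => F ^ n := by
    refine Module.End.eigenvectors_linearIndependent' D (fun n : ℕ => (n : ℂ) * c) ?_ _ ?_
    · intro a b hab
      simpa [hc] using hab
    · intro n
      refine ⟨Module.End.mem_eigenspace_iff.mpr ?_, hne n⟩
      simpa [D] using key n
  have := hli.finite
  exact not_finite ℕ

/-- A triple of endomorphisms with the relations of `sl₂`. -/
structure IsSl2Rep (H E F : End ℂ V) : Prop where
  e_f : E * F - F * E = H
  h_e : H * E - E * H = (2 : ℂ) • E
  h_f : H * F - F * H = -((2 : ℂ) • F)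

namespace IsSl2Rep

variable {H E F : End ℂ V}

lemma symm (t : IsSl2Rep H E F) : IsSl2Rep (-H) F E where
  e_f := by rw [← t.e_f]; abel
  h_e := by
    have := t.h_f
    rw [← neg_inj, neg_neg] at this
    rw [← this]; noncomm_ring
  h_f := by rw [← t.h_e]; noncomm_ring

lemma isNilpotent_e [FiniteDimensional ℂ V] (t : IsSl2Rep H E F) : IsNilpotent E :=
  isNilpotent_of_commutator_eq_smul H E 2 two_ne_zero t.h_e

lemma e_f_apply (t : IsSl2Rep H E F) (v : V) : E (F v) = F (E v) + H v := by
  have := LinearMap.congr_fun t.e_f v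
  simp at this
  rw [← this]; abel

lemma h_e_apply (t : IsSl2Rep H E F) (v : V) : H (E v) = E (H v) + (2 : ℂ) • E v := by
  have := LinearMap.congr_fun t.h_e v
  simp at this
  rw [← this]; abel

lemma h_f_apply (t : IsSl2Rep H E F) (v : V) : H (F v) = F (H v) - (2 : ℂ) • F v := by
  have := LinearMap.congr_fun t.h_f v
  simp at this
  rw [sub_eq_iff_eq_add] at this
  rw [this]; abel

lemma h_e_pow (t : IsSl2Rep H E F) {w : V} {m : ℂ} (hw : H w = m • w) (i : ℕ) :
    H ((E ^ i) w) = (m + 2 * i) • (E ^ i) w := by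
  induction i with
  | zero => simpa using hw
  | succ i ih =>
    rw [pow_succ', Module.End.mul_apply, t.h_e_apply, ih, map_smul, ← add_smul]
    push_cast; ring_nf

/-- Moving `F` past each further `E` subtracts the weight `m + 2j` of `E^j w`; the sum over `j = 1,
…, i` is `i (m + i + 1)`. -/
lemma f_e_pow_succ (t : IsSl2Rep H E F) {w : V} {m : ℂ} (hw : H w = m • w) {a : ℂ}
    (hf : F (E w) = a • w) (i : ℕ) :
    F ((E ^ (i + 1)) w) = (a - i * (m + i + 1)) • (E ^ i) w := by
  induction i with
  | zero => simpa using hf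
  | succ i ih =>
    have h1 := t.e_f_apply ((E ^ (i + 1)) w)
    rw [t.h_e_pow hw, ih, map_smul, ← Module.End.mul_apply E, ← pow_succ'] at h1
    rw [pow_succ' E (i + 1), Module.End.mul_apply, ← sub_eq_iff_eq_add.mpr h1, ← sub_smul]
    congr 1
    push_cast; ring

/-- Let `w` be an `H`-eigenvector and an eigenvector of `F E`. The chain `w, E w, E² w, …` stops, and
this determines the eigenvalue of `F E`. -/
lemma exists_nat_of_f_e [FiniteDimensional ℂ V] (t : IsSl2Rep H E F) {w : V}
    (hw0 : w ≠ 0) {m : ℂ} (hw : H w = m • w) {a : ℂ} (hf : F (E w) = a • w) : ∃ i : ℕ, a = i * (m + i + 1) := by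
  obtain ⟨n, hn⟩ := t.isNilpotent_e
  have hex : ∃ k, (E ^ k) w = 0 := ⟨n, by simp [hn]⟩
  classical
  have hpos : Nat.find hex ≠ 0 := by
    intro h0
    have := Nat.find_spec hex
    rw [h0] at this
    exact hw0 (by simpa using this)
  obtain ⟨i, hi⟩ := Nat.exists_eq_succ_of_ne_zero hpos
  have hs := Nat.find_spec hex
  have hm : (E ^ i) w ≠ 0 := Nat.find_min hex (by omega)
  rw [hi] at hs
  have := t.f_e_pow_succ hw hf i
  rw [Nat.succ_eq_add_one] at hs
  rw [hs, map_zero, eq_comm, smul_eq_zero] at this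
  refine ⟨i, ?_⟩
  linear_combination this.resolve_right hm

/-- The weight of a lowest weight vector is a nonpositive integer. -/
lemma exists_nat_of_f_eq_zero [FiniteDimensional ℂ V] (t : IsSl2Rep H E F) {w : V}
    (hw0 : w ≠ 0) {m : ℂ} (hw : H w = m • w) (hf : F w = 0) : ∃ i : ℕ, m = -i := by
  have h1 : F (E w) = (-m) • w := by
    have := t.e_f_apply w
    rw [hf, map_zero, hw] at this
    rw [neg_smul]; exact eq_neg_of_add_eq_zero_left this.symm
  obtain ⟨i, hi⟩ := t.exists_nat_of_f_e hw0 hw h1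
  refine ⟨i, ?_⟩
  have h2 : (m + i) * ((i : ℂ) + 1) = 0 := by linear_combination -hi
  have h3 : (i : ℂ) + 1 ≠ 0 := by exact_mod_cast Nat.succ_ne_zero i
  linear_combination (mul_eq_zero.mp h2).resolve_right h3

/-- In a finite-dimensional representation of `sl₂`, `ker E ∩ im F = 0`. -/
lemma disjoint_ker_range [FiniteDimensional ℂ V] (t : IsSl2Rep H E F) : Disjoint E.ker F.range := by
  rw [disjoint_iff]
  by_contra hne
  obtain ⟨v, ⟨hvE, hvF⟩, hv0, μ, hμ⟩ := exists_eigenvector_mem H _ hne (by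
    rintro x ⟨hxE, y, rfl⟩
    refine ⟨?_, H y - (2 : ℂ) • y, ?_⟩
    · simp only [SetLike.mem_coe, LinearMap.mem_ker] at hxE ⊢
      have := t.h_e_apply (F y)
      rw [hxE] at this
      simpa using this.symm
    · rw [t.h_f_apply]; simp)
  simp only [SetLike.mem_coe, LinearMap.mem_ker] at hvE
  obtain ⟨n, hn⟩ := t.symm.exists_nat_of_f_eq_zero (m := -μ) hv0 (by simp [hμ]) hvE
  rw [neg_inj] at hn
  subst hn
  -- `H` is not known to be diagonalizable, so a weight vector is sought in `F⁻¹(ℂ v)`. There `T = H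
  -- - (n + 2)` takes values in `ker F`. Were `T` onto, `F` would vanish on `K`, contradicting `F w₀
  -- = v ≠ 0`. So `T` has a kernel vector `w`, of weight `n + 2`.
  let K : Submodule ℂ V := (Submodule.span ℂ {v}).comap F
  obtain ⟨w₀, hw₀⟩ := hvF
  have hKH : ∀ x ∈ K, H x ∈ K := by
    intro x hx
    obtain ⟨c, hc⟩ := Submodule.mem_span_singleton.mp hx
    refine Submodule.mem_span_singleton.mpr ⟨c * (n + 2), ?_⟩
    have := t.h_f_apply x
    rw [eq_sub_iff_add_eq] at this
    rw [← this, ← hc, map_smul, hμ]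
    module
  let T : End ℂ V := H - ((n : ℂ) + 2) • 1
  have hTF : ∀ x ∈ K, F (T x) = 0 := by
    intro x hx
    obtain ⟨c, hc⟩ := Submodule.mem_span_singleton.mp hx
    have := t.h_f_apply x
    rw [eq_sub_iff_add_eq] at this
    simp only [T, LinearMap.sub_apply, LinearMap.smul_apply, Module.End.one_apply, map_sub, map_smul,
      ← this, ← hc, hμ]
    module
  have hTK : ∀ x ∈ K, T x ∈ K := fun x hx => by
    simp only [K, Submodule.mem_comap, hTF x hx, Submodule.zero_mem]
  have hinj : ¬ Function.Injective (T.restrict hTK) := by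
    intro hinj
    obtain ⟨w, hw⟩ := (LinearMap.injective_iff_surjective.mp hinj)
      ⟨w₀, Submodule.mem_span_singleton.mpr ⟨1, by simp [hw₀]⟩⟩
    have hw' : T w = w₀ := congrArg Subtype.val hw
    have := hTF w w.2
    rw [hw', hw₀] at this
    exact hv0 this
  rw [← LinearMap.ker_eq_bot, Submodule.eq_bot_iff] at hinj
  push Not at hinj
  obtain ⟨⟨w, hwK⟩, hw, hw0⟩ := hinj
  have hw0 : w ≠ 0 := by simpa using hw0
  have hTw : T w = 0 := congrArg Subtype.val (LinearMap.mem_ker.mp hw)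
  have hHw : H w = ((n : ℂ) + 2) • w := by
    simpa [T, sub_eq_zero] using hTw
  obtain ⟨c, hc⟩ := Submodule.mem_span_singleton.mp hwK
  have hFE : F (E w) = (-((n : ℂ) + 2)) • w := by
    have := t.e_f_apply w
    rw [← hc, map_smul, hvE, smul_zero, hHw] at this
    rw [neg_smul]; exact eq_neg_of_add_eq_zero_left this.symm
  -- The chain of `w` forces the negative number `-(n + 2)` to equal `i (n + i + 3) ≥ 0`.
  obtain ⟨i, hi⟩ := t.exists_nat_of_f_e hw0 hHw hFE
  have h0 : ((i * (n + 2 + i + 1) + (n + 2) : ℕ) : ℂ) = 0 := by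
    push_cast; linear_combination -hi
  have := Nat.cast_eq_zero.mp h0
  omega

end IsSl2Rep
end LinearAlgebra
-- The filtration by kernels of powers of `F`, and the partial inverse of `E`.
section LinearAlgebra

variable {V : Type*} [AddCommGroup V] [Module ℂ V]

lemma finrank_map_of_disjoint_ker {W : Type*} [AddCommGroup W] [Module ℂ W] (T : V →ₗ[ℂ] W)
    (S : Submodule ℂ V) (hS : Disjoint S T.ker) : finrank ℂ (S.map T) = finrank ℂ S := by
  rw [← LinearMap.range_domRestrict]
  refine LinearMap.finrank_range_of_inj ?_
  rw [← LinearMap.ker_eq_bot, Submodule.eq_bot_iff]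
  rintro ⟨x, hx⟩ h
  have : x = 0 := (Submodule.disjoint_def.mp hS) x hx (by simpa using h)
  simpa using this

namespace IsSl2Rep

variable {H E F : End ℂ V}

/-- From `F H = (H + 2) F`. The filtration by `ker F^k` replaces the weight grading; `H` preserves
it and `E` raises it by one step. -/
lemma f_pow_h (t : IsSl2Rep H E F) (k : ℕ) : ∀ b, (F ^ k) b = 0 → (F ^ k) (H b) = 0 := by
  induction k with
  | zero => intro b hb; simp_all
  | succ k ih =>
    intro b hb
    rw [pow_succ, Module.End.mul_apply] at hb ⊢
    rw [← sub_add_cancel (F (H b)) ((2 : ℂ) • F b), ← t.h_f_apply, map_add, ih _ hb]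
    simp [hb]

lemma f_pow_e (t : IsSl2Rep H E F) (k : ℕ) : ∀ b, (F ^ k) b = 0 → (F ^ (k + 1)) (E b) = 0 := by
  induction k with
  | zero => intro b hb; simp_all
  | succ k ih =>
    intro b hb
    have h1 := t.e_f_apply b
    have h2 := t.f_pow_h (k + 1) b hb
    rw [pow_succ, Module.End.mul_apply] at hb
    rw [pow_succ, Module.End.mul_apply, eq_sub_of_add_eq h1.symm, map_sub, h2, ih _ hb, sub_zero]

variable [FiniteDimensional ℂ V]

lemma finrank_ker_le (t : IsSl2Rep H E F) : finrank ℂ E.ker ≤ finrank ℂ F.ker := by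
  have h1 := Submodule.finrank_add_finrank_le_of_disjoint t.disjoint_ker_range
  have h2 := F.finrank_range_add_finrank_ker
  omega

lemma finrank_ker_eq (t : IsSl2Rep H E F) : finrank ℂ E.ker = finrank ℂ F.ker :=
  le_antisymm t.finrank_ker_le t.symm.finrank_ker_le

lemma isCompl_ker_range (t : IsSl2Rep H E F) : IsCompl E.ker F.range := by
  refine (Submodule.isCompl_iff_disjoint _ _ ?_).mpr t.disjoint_ker_range
  have h2 := F.finrank_range_add_finrank_ker
  have := t.finrank_ker_eq
  omega

/-- `ad e : [f, g] → [e, g]` has an inverse, which is extended by zero on the kernel of `F`. -/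
lemma exists_section (t : IsSl2Rep H E F) : ∃ s : End ℂ V, (∀ x, s x ∈ F.range) ∧
    (∀ x ∈ F.ker, s x = 0) ∧ (∀ b ∈ F.range, s (E b) = b) ∧ ∀ x, E (s (E x)) = E x := by
  have hinj : (E.domRestrict F.range).ker = ⊥ := by
    rw [Submodule.eq_bot_iff]
    rintro ⟨x, hx⟩ h
    have : x = 0 := (Submodule.disjoint_def.mp t.disjoint_ker_range) x (by simpa using h) hx
    simpa using this
  obtain ⟨g, hg⟩ := LinearMap.exists_leftInverse_of_injective _ hinj
  -- Projection to `im E` along `ker F`, so that composing with the left inverse `g` gives zero on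
  -- `ker F`.
  let p := (E.range).subtype ∘ₗ Submodule.projectionOnto _ _ t.symm.isCompl_ker_range.symm
  have hpE : ∀ x, p (E x) = E x := fun x => by
    have := Submodule.projectionOnto_apply_left t.symm.isCompl_ker_range.symm
      ⟨E x, LinearMap.mem_range_self E x⟩
    exact congrArg Subtype.val this
  have hsE : ∀ b ∈ F.range, (F.range.subtype ∘ₗ g ∘ₗ p) (E b) = b := fun b hb => by
    simpa [hpE] using congrArg Subtype.val (LinearMap.congr_fun hg ⟨b, hb⟩)
  refine ⟨F.range.subtype ∘ₗ g ∘ₗ p, fun x => (g (p x)).2, fun x hx => ?_, hsE, fun x => ?_⟩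
  · have := (Submodule.projectionOnto_apply_eq_zero_iff t.symm.isCompl_ker_range.symm).mpr hx
    simp [p, this]
  · obtain ⟨a, ha, b, hb, rfl⟩ := Submodule.mem_sup.mp
      (t.isCompl_ker_range.sup_eq_top ▸ Submodule.mem_top : x ∈ E.ker ⊔ F.range)
    rw [map_add, LinearMap.mem_ker.mp ha, zero_add, hsE b hb]

/-- A section as in `exists_section` lowers the filtration of `V` by the kernels of the powers of
`F`. -/
lemma section_mem_ker_pow (t : IsSl2Rep H E F) {s : End ℂ V} (hs0 : ∀ x ∈ F.ker, s x = 0)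
    (hsE : ∀ b ∈ F.range, s (E b) = b) (k : ℕ) {w : V} (hw : (F ^ (k + 1)) w = 0) :
    (F ^ k) (s w) = 0 := by
  -- `E : A → B` and `F : B → A` are both injective, so dimensions agree and `E A = B`.
  let A := F.range ⊓ (F ^ k).ker
  let B := E.range ⊓ (F ^ (k + 1)).ker
  have hle : A.map E ≤ B := by
    rintro _ ⟨a, ⟨-, ha⟩, rfl⟩
    exact ⟨⟨a, rfl⟩, t.f_pow_e k a ha⟩
  have hBA : B.map F ≤ A := by
    rintro _ ⟨b, ⟨-, hb⟩, rfl⟩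
    refine ⟨⟨b, rfl⟩, ?_⟩
    simpa [pow_succ] using hb
  have hA : finrank ℂ (A.map E) = finrank ℂ A :=
    finrank_map_of_disjoint_ker _ _ (t.disjoint_ker_range.symm.mono_left inf_le_left)
  have hB : finrank ℂ (B.map F) = finrank ℂ B :=
    finrank_map_of_disjoint_ker _ _ (t.symm.disjoint_ker_range.symm.mono_left inf_le_left)
  have hAB : A.map E = B := Submodule.eq_of_le_of_finrank_le hle (by
    rw [hA, ← hB]; exact Submodule.finrank_mono hBA)
  obtain ⟨c, hc, w', hw', rfl⟩ := Submodule.mem_sup.mp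
    (t.symm.isCompl_ker_range.sup_eq_top ▸ Submodule.mem_top : w ∈ F.ker ⊔ E.range)
  have hwB : w' ∈ B := by
    refine ⟨hw', ?_⟩
    have : (F ^ (k + 1)) c = 0 := by
      rw [pow_succ, Module.End.mul_apply, LinearMap.mem_ker.mp hc, map_zero]
    rw [map_add, this, zero_add] at hw
    exact hw
  rw [← hAB] at hwB
  obtain ⟨a, ⟨haF, ha⟩, rfl⟩ := hwB
  rw [map_add, hs0 c hc, zero_add, hsE a haF]
  exact ha

/-- If `U` commutes with `F` then `s U` is nilpotent, with an exponent that does not depend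
on `U`. -/
lemma section_mul_pow_eq_zero (t : IsSl2Rep H E F) {s : End ℂ V} (hs0 : ∀ x ∈ F.ker, s x = 0)
    (hsE : ∀ b ∈ F.range, s (E b) = b) {n : ℕ} (hn : F ^ n = 0) {U : End ℂ V} (hU : Commute F U) :
    (s * U) ^ n = 0 := by
  have key : ∀ k, ∀ w, (F ^ k) w = 0 → ((s * U) ^ k) w = 0 := by
    intro k
    induction k with
    | zero => intro w hw; simpa using hw
    | succ k ih =>
      intro w hw
      rw [pow_succ, Module.End.mul_apply]
      refine ih _ (t.section_mem_ker_pow hs0 hsE k ?_)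
      rw [← Module.End.mul_apply, (hU.pow_left _).eq, Module.End.mul_apply, hw, map_zero]
  ext w
  simpa using key n w (by simp [hn])

end IsSl2Rep
end LinearAlgebra
-- Exponentials of ad-nilpotent elements.
section Exp

variable {g : Type*} [LieRing g] [LieAlgebra ℂ g]

lemma nilpotentExp_eq_sum {N : End ℂ g} {k : ℕ} (hN : N ^ k = 0) :
    nilpotentExp N = ∑ i ∈ Finset.range k, ((i.factorial : ℂ)⁻¹) • N ^ i := by
  refine Finset.sum_subset (Finset.range_mono (Nat.sInf_le hN)) fun i _ hi => ?_
  have h0 : N ^ nilpotencyClass N = 0 := pow_nilpotencyClass ⟨k, hN⟩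
  rw [pow_eq_zero_of_le (by simpa using hi) h0, smul_zero]

/-- The exponential of a nilpotent inner derivation is an automorphism of the Lie algebra. -/
lemma exists_lieEquiv_eq_nilpotentExp {x : g} (hx : IsNilpotent (LieAlgebra.ad ℂ g x)) :
    ∃ a : g ≃ₗ⁅ℂ⁆ g, (a : g →ₗ[ℂ] g) = nilpotentExp (LieAlgebra.ad ℂ g x) := by
  -- `IsNilpotent.exp` has rational coefficients; with scalars restricted from `ℂ` they agree with
  -- those of `nilpotentExp`.
  let _ : Module ℚ g := Module.compHom g (algebraMap ℚ ℂ)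
  let _ : LieAlgebra ℚ g := { lie_smul := fun q y z => lie_smul (q : ℂ) y z }
  have hD : (LieDerivation.ad ℂ g x).toLinearMap = LieAlgebra.ad ℂ g x := by
    ext y; simp
  have hx' : IsNilpotent (LieDerivation.ad ℂ g x).toLinearMap := hD ▸ hx
  refine ⟨LieDerivation.exp _ hx', ?_⟩
  ext y
  have h1 : IsNilpotent.exp (LieDerivation.ad ℂ g x).toLinearMap =
      nilpotentExp (LieAlgebra.ad ℂ g x) := by
    rw [hD]
    unfold IsNilpotent.exp nilpotentExp
    refine Finset.sum_congr rfl fun i _ => ?_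
    ext z
    change (((i.factorial : ℚ)⁻¹ : ℚ) : ℂ) • ((LieAlgebra.ad ℂ g x) ^ i) z =
      ((i.factorial : ℂ)⁻¹) • ((LieAlgebra.ad ℂ g x) ^ i) z
    push_cast
    rfl
  rw [← h1]
  rfl

lemma nilpotentExp_mem_adjointGroup {x : g} (hx : IsNilpotent (LieAlgebra.ad ℂ g x)) :
    ∃ a ∈ adjointGroup g, (a : g →ₗ[ℂ] g) = nilpotentExp (LieAlgebra.ad ℂ g x) := by
  obtain ⟨a, ha⟩ := exists_lieEquiv_eq_nilpotentExp hx
  exact ⟨a.toLinearEquiv, Subgroup.subset_closure ⟨x, hx, ha⟩, ha⟩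

/-- `ad (a m)` is the conjugate of `ad m` by `a`. -/
lemma isNilpotent_ad_apply_lieEquiv (a : g ≃ₗ⁅ℂ⁆ g) {m : g}
    (hm : IsNilpotent (LieAlgebra.ad ℂ g m)) : IsNilpotent (LieAlgebra.ad ℂ g (a m)) := by
  obtain ⟨k, hk⟩ := hm
  have key : ∀ k, ∀ z, ((LieAlgebra.ad ℂ g (a m)) ^ k) (a z) =
      a (((LieAlgebra.ad ℂ g m) ^ k) z) := by
    intro k
    induction k with
    | zero => simp
    | succ k ih =>
      intro z
      rw [pow_succ, pow_succ, Module.End.mul_apply, Module.End.mul_apply, LieAlgebra.ad_apply,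
        LieAlgebra.ad_apply, ← LieEquiv.map_lie, ih]
  refine ⟨k, LinearMap.ext fun z => ?_⟩
  obtain ⟨z, rfl⟩ := a.surjective z
  have := key k z
  rw [hk] at this
  simpa using this

/-- If a polynomial with coefficients in a vector space has all its values in a subspace then so are
its coefficients. -/
lemma mem_of_forall_sum_pow_smul_mem {V : Type*} [AddCommGroup V] [Module ℂ V]
    (S : Submodule ℂ V) (n : ℕ) (c : ℕ → V)
    (h : ∀ t : ℂ, ∑ i ∈ Finset.range n, t ^ i • c i ∈ S) {j : ℕ} (hj : j < n) : c j ∈ S := by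
  by_contra hc
  obtain ⟨l, hl, hlS⟩ := Submodule.exists_dual_map_eq_bot_of_notMem hc inferInstance
  have hS : ∀ x ∈ S, l x = 0 := fun x hx => by
    have : l x ∈ S.map l := ⟨x, hx, rfl⟩
    rwa [hlS] at this
  let p : Polynomial ℂ := ∑ i ∈ Finset.range n, Polynomial.monomial i (l (c i))
  have hp : p = 0 := by
    refine Polynomial.funext fun t => ?_
    have := hS _ (h t)
    simp only [map_sum, map_smul, smul_eq_mul] at this
    simp only [p, Polynomial.eval_finsetSum, Polynomial.eval_monomial, Polynomial.eval_zero]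
    rw [← this]
    exact Finset.sum_congr rfl fun _ _ => mul_comm _ _
  have := congrArg (fun q => Polynomial.coeff q j) hp
  simp [p, Polynomial.coeff_monomial, hj] at this
  exact hl this

variable (g) in
/-- The span of the ad-nilpotent elements of `g`. -/
def adNilpotentSpan : Submodule ℂ g :=
  Submodule.span ℂ {x | IsNilpotent (LieAlgebra.ad ℂ g x)}

/-- The span of the ad-nilpotent elements is closed under the bracket. -/
lemma lie_mem_adNilpotentSpan {x y : g} (hx : x ∈ adNilpotentSpan g) (hy : y ∈ adNilpotentSpan g) :
    ⁅x, y⁆ ∈ adNilpotentSpan g := by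
  induction hx using Submodule.span_induction with
  | zero => simp
  | add u v _ _ hu hv => rw [add_lie]; exact add_mem hu hv
  | smul t u _ hu => rw [smul_lie]; exact Submodule.smul_mem _ t hu
  | mem n hn =>
    induction hy using Submodule.span_induction with
    | zero => simp
    | add u v _ _ hu hv => rw [lie_add]; exact add_mem hu hv
    | smul t u _ hu => rw [lie_smul]; exact Submodule.smul_mem _ t hu
    | mem m hm =>
      obtain ⟨k, hk⟩ := hn
      have hk2 : (LieAlgebra.ad ℂ g n) ^ (k + 2) = 0 := by rw [pow_add, hk, zero_mul]
      -- `exp (t ad n) m` is ad-nilpotent for all `t`, and its coefficient of `t` is `[n, m]`. The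
      -- exponent `k + 2` keeps this coefficient in range even for `k = 0`.
      have := mem_of_forall_sum_pow_smul_mem (adNilpotentSpan g) (k + 2)
        (fun i => ((i.factorial : ℂ)⁻¹) • ((LieAlgebra.ad ℂ g n) ^ i) m) (fun t => ?_)
        (j := 1) (by omega)
      · simpa using this
      · have ht : (LieAlgebra.ad ℂ g (t • n)) ^ (k + 2) = 0 := by
          rw [map_smul, smul_pow, hk2, smul_zero]
        obtain ⟨a, ha⟩ := exists_lieEquiv_eq_nilpotentExp (x := t • n) ⟨_, ht⟩
        have h2 : a m ∈ adNilpotentSpan g :=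
          Submodule.subset_span (isNilpotent_ad_apply_lieEquiv a hm)
        have h3 : a m = nilpotentExp (LieAlgebra.ad ℂ g (t • n)) m := LinearMap.congr_fun ha m
        rw [h3, nilpotentExp_eq_sum ht, LinearMap.sum_apply] at h2
        convert h2 using 2 with i
        rw [map_smul, smul_pow, LinearMap.smul_apply, LinearMap.smul_apply, smul_comm]

end Exp
-- Orthogonality to the ad-nilpotent elements.
section Reductive

variable {g : Type*} [LieRing g] [LieAlgebra ℂ g] [FiniteDimensional ℂ g]

variable (g) in
/-- The root spaces of a Cartan subalgebra generate an ideal with solvable quotient, and this ideal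
lies in the span of the ad-nilpotent elements. -/
lemma exists_lieIdeal_le_adNilpotentSpan :
    ∃ I : LieIdeal ℂ g, (∀ x ∈ I, x ∈ adNilpotentSpan g) ∧
      ∃ k, LieAlgebra.derivedSeries ℂ g k ≤ I := by
  obtain ⟨r, hr⟩ := LieAlgebra.exists_isCartanSubalgebra_engel ℂ g
  set H := LieSubalgebra.engel ℂ r
  let X : Set g := {x | ∃ χ : H → ℂ, χ ≠ 0 ∧ x ∈ LieAlgebra.rootSpace H χ}
  let S := LieSubalgebra.lieSpan ℂ g X
  -- `H` normalizes `S` and `g = H + S`, so `S` is an ideal, and `g / S` is a quotient of the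
  -- nilpotent algebra `H`.
  have hHS : ∀ z ∈ H, ∀ w ∈ S, ⁅z, w⁆ ∈ S := by
    intro z hz w hw
    induction hw using LieSubalgebra.lieSpan_induction with
    | mem x hx =>
      obtain ⟨χ, hχ, hx⟩ := hx
      exact LieSubalgebra.subset_lieSpan ⟨χ, hχ, LieSubmodule.lie_mem _ (x := (⟨z, hz⟩ : H)) hx⟩
    | zero => simp
    | add u v _ _ hu hv => rw [lie_add]; exact add_mem hu hv
    | smul t u _ hu => rw [lie_smul]; exact S.smul_mem t hu
    | lie u v hu' hv' hu hv =>
      rw [leibniz_lie]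
      exact add_mem (S.lie_mem hu hv') (S.lie_mem hu' hv)
  have htop : ∀ z : g, ∃ a ∈ H, ∃ b ∈ S, a + b = z := by
    intro z
    have hz : z ∈ H.toLieSubmodule ⊔
        ⨆ α : LieModule.Weight ℂ H g, ⨆ (_ : α.IsNonZero), LieAlgebra.rootSpace H α := by
      rw [LieAlgebra.cartan_sup_iSup_rootSpace_eq_top]; trivial
    obtain ⟨a, ha, b, hb, rfl⟩ := (LieSubmodule.mem_sup _ _ _).mp hz
    refine ⟨a, by simpa using ha, b, ?_, rfl⟩
    clear hz
    induction hb using LieSubmodule.iSup_induction' with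
    | zero => exact S.zero_mem
    | add u v _ _ hu hv => exact add_mem hu hv
    | mem α x hx =>
      by_cases hα : α.IsNonZero
      · rw [iSup_pos hα] at hx
        refine LieSubalgebra.subset_lieSpan ⟨α, hα, hx⟩
      · rw [iSup_neg hα] at hx
        rw [(LieSubmodule.mem_bot _).mp hx]
        exact S.zero_mem
  have hS : ∀ x ∈ S, x ∈ adNilpotentSpan g := by
    intro x hx
    induction hx using LieSubalgebra.lieSpan_induction with
    | mem x hx =>
      obtain ⟨χ, hχ, hx⟩ := hx
      exact Submodule.subset_span (LieAlgebra.isNilpotent_ad_of_mem_rootSpace H hχ hx)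
    | zero => simp
    | add u v _ _ hu hv => exact add_mem hu hv
    | smul t u _ hu => exact Submodule.smul_mem _ t hu
    | lie u v hu' hv' hu hv => exact lie_mem_adNilpotentSpan hu hv
  let I : LieIdeal ℂ g :=
    { S.toSubmodule with
      lie_mem := by
        intro z w hw
        obtain ⟨a, ha, b, hb, rfl⟩ := htop z
        rw [add_lie]
        exact add_mem (hHS a ha w hw) (S.lie_mem hb hw) }
  refine ⟨I, hS, ?_⟩
  let π : g →ₗ⁅ℂ⁆ g ⧸ I :=
    { (LieSubmodule.Quotient.mk' I : g →ₗ[ℂ] g ⧸ I) with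
      map_lie' := rfl }
  have hπ : ∀ z, π z = 0 ↔ z ∈ I := fun z => LieSubmodule.Quotient.mk_eq_zero I
  have hsurj : Function.Surjective (π.comp H.incl) := by
    intro q
    obtain ⟨z, rfl⟩ := LieSubmodule.Quotient.surjective_mk' I q
    obtain ⟨a, ha, b, hb, rfl⟩ := htop z
    refine ⟨⟨a, ha⟩, ?_⟩
    change π a = π (a + b)
    rw [map_add, (hπ b).mpr hb, add_zero]
  have hsolv : LieAlgebra.IsSolvable (g ⧸ I) := hsurj.lieAlgebra_isSolvable
  obtain ⟨k, hk⟩ := hsolv.solvable ℂ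
  refine ⟨k, fun z hz => (hπ z).mp ?_⟩
  have := LieIdeal.derivedSeries_map_le (f := π) k (LieIdeal.mem_map hz)
  rwa [hk] at this

/-- The elements that are orthogonal to all ad-nilpotent elements are central. -/
lemma mem_center_of_orthogonal (hg : IsReductive g) (κ : LinearMap.BilinForm ℂ g)
    (hκ_nondeg : κ.Nondegenerate) (hκ_inv : κ.lieInvariant g) {x : g}
    (hx : ∀ n ∈ adNilpotentSpan g, κ n x = 0) : x ∈ LieAlgebra.center ℂ g := by
  obtain ⟨I, hI, hsolv⟩ := exists_lieIdeal_le_adNilpotentSpan g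
  let C : LieIdeal ℂ g := LieAlgebra.InvariantForm.orthogonal κ hκ_inv I
  have hC : ∀ y, y ∈ C ↔ ∀ n ∈ I, κ n y = 0 :=
    LieAlgebra.InvariantForm.mem_orthogonal κ hκ_inv I
  have hIC : ⁅I, C⁆ = ⊥ := by
    rw [LieSubmodule.lie_eq_bot_iff]
    intro n hn c hc
    refine hκ_nondeg.2 _ fun z => ?_
    rw [← neg_eq_zero, ← hκ_inv]
    exact (hC c).mp hc _ (lie_mem_left ℂ g I n z hn)
  -- A term of the derived series of `C` lies in `I ∩ C`, so the next one lies in `[I, C] = 0`.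
  -- Hence `C` is contained in the radical, which is the center.
  have hCs : LieAlgebra.IsSolvable C := by
    obtain ⟨k, h1⟩ := hsolv
    have h2 : LieAlgebra.derivedSeriesOfIdeal ℂ g k C ≤ I :=
      (LieAlgebra.derivedSeriesOfIdeal_mono le_top k).trans h1
    refine LieAlgebra.IsSolvable.mk (R := ℂ) (k := k + 1) ?_
    rw [LieIdeal.derivedSeries_eq_bot_iff, LieAlgebra.derivedSeriesOfIdeal_succ, eq_bot_iff, ← hIC]
    exact LieSubmodule.mono_lie h2 (LieAlgebra.derivedSeriesOfIdeal_le_self C k)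
  rw [← hg]
  exact (LieAlgebra.LieIdeal.solvable_iff_le_radical ℂ g C).mp hCs
    ((hC x).mpr fun n hn => hx n (hI n hn))

end Reductive
-- Polynomial maps and their differentials.
section PolynomialMaps

variable {V W : Type*} [AddCommGroup V] [Module ℂ V] [AddCommGroup W] [Module ℂ W]

/-- A map between vector spaces is polynomial if each linear coordinate of it is a polynomial
function. -/
def IsPolynomialMap (F : V → W) : Prop :=
  ∀ l : Dual ℂ W, (fun v => l (F v)) ∈ polynomialFunctions V

lemma dual_mem_polynomialFunctions (l : Dual ℂ V) : (l : V → ℂ) ∈ polynomialFunctions V :=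
  Algebra.subset_adjoin ⟨l, rfl⟩

lemma const_mem_polynomialFunctions (c : ℂ) : (fun _ : V => c) ∈ polynomialFunctions V :=
  (polynomialFunctions V).algebraMap_mem c

namespace IsPolynomialMap

lemma linearMap (T : V →ₗ[ℂ] W) : IsPolynomialMap T :=
  fun l => dual_mem_polynomialFunctions (l ∘ₗ T)

lemma const (w : W) : IsPolynomialMap fun _ : V => w :=
  fun l => const_mem_polynomialFunctions (l w)

lemma sub {F G : V → W} (hF : IsPolynomialMap F) (hG : IsPolynomialMap G) :
    IsPolynomialMap fun v => F v - G v := fun l => by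
  simp only [map_sub]
  exact sub_mem (hF l) (hG l)

lemma sum {ι : Type*} (s : Finset ι) {F : ι → V → W} (hF : ∀ i ∈ s, IsPolynomialMap (F i)) :
    IsPolynomialMap fun v => ∑ i ∈ s, F i v := fun l => by
  have : (fun v => l (∑ i ∈ s, F i v)) = ∑ i ∈ s, fun v => l (F i v) := by
    ext v; simp
  rw [this]
  exact sum_mem fun i hi => hF i hi l

lemma prodMk {W' : Type*} [AddCommGroup W'] [Module ℂ W'] {F : V → W} {G : V → W'}
    (hF : IsPolynomialMap F) (hG : IsPolynomialMap G) :
    IsPolynomialMap fun v => (F v, G v) := fun l => by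
  have : (fun v => l (F v, G v)) =
      (fun v => (l ∘ₗ LinearMap.inl ℂ W W') (F v)) + fun v => (l ∘ₗ LinearMap.inr ℂ W W') (G v) := by
    ext v
    simp [← map_add]
  rw [this]
  exact add_mem (hF _) (hG _)

lemma bilinear {W₁ W₂ : Type*} [AddCommGroup W₁] [Module ℂ W₁] [FiniteDimensional ℂ W₁]
    [AddCommGroup W₂] [Module ℂ W₂] (B : W₁ →ₗ[ℂ] W₂ →ₗ[ℂ] W) {F : V → W₁} {G : V → W₂}
    (hF : IsPolynomialMap F) (hG : IsPolynomialMap G) :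
    IsPolynomialMap fun v => B (F v) (G v) := fun l => by
  let b := Module.finBasis ℂ W₁
  have : (fun v => l (B (F v) (G v))) =
      ∑ i, (fun v => b.coord i (F v)) * fun v => (l ∘ₗ B (b i)) (G v) := by
    ext v
    conv_lhs => rw [← b.sum_repr (F v)]
    simp only [map_sum, map_smul, LinearMap.sum_apply, LinearMap.smul_apply, smul_eq_mul,
      Finset.sum_apply, Pi.mul_apply, Basis.coord_apply, LinearMap.comp_apply]
  rw [this]
  exact sum_mem fun i _ => mul_mem (hF _) (hG _)

lemma comp_linearMap {V' : Type*} [AddCommGroup V'] [Module ℂ V'] {F : V → W}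
    (hF : IsPolynomialMap F) (T : V' →ₗ[ℂ] V) : IsPolynomialMap fun v => F (T v) := fun l => by
  have key : ∀ p ∈ polynomialFunctions V, (fun v => p (T v)) ∈ polynomialFunctions V' := by
    intro p hp
    induction hp using Algebra.adjoin_induction with
    | mem p hp =>
      obtain ⟨φ, rfl⟩ := hp
      exact dual_mem_polynomialFunctions (φ ∘ₗ T)
    | algebraMap r => exact const_mem_polynomialFunctions r
    | add p q _ _ hp hq => exact add_mem hp hq
    | mul p q _ _ hp hq => exact mul_mem hp hq
  exact key _ (hF l)

lemma isRegularMap {S : Set V} {T : Set W} {φ : S → T} {F : V → W} (hF : IsPolynomialMap F)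
    (h : ∀ s : S, (φ s : W) = F s) : IsRegularMap φ :=
  fun l => ⟨_, hF l, fun s => by rw [h]⟩

end IsPolynomialMap

/-- A polynomial function on a dual space has a polynomial differential, which computes its
derivatives along curves. -/
lemma exists_differential [FiniteDimensional ℂ V] {P : Dual ℂ V → ℂ}
    (hP : P ∈ polynomialFunctions (Dual ℂ V)) :
    ∃ x : Dual ℂ V → V, IsPolynomialMap x ∧ ∀ (c : ℂ → Dual ℂ V) (c' : Dual ℂ V) (t : ℂ),
      (∀ v : V, HasDerivAt (fun s => c s v) (c' v) t) →
        HasDerivAt (fun s => P (c s)) (c' (x (c t))) t := by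
  -- General curves are allowed because the differential is needed along `exp (t ad n)` as well as
  -- along lines.
  induction hP using Algebra.adjoin_induction with
  | mem P hP =>
    obtain ⟨φ, rfl⟩ := hP
    obtain ⟨v, rfl⟩ := (Module.evalEquiv ℂ V).surjective φ
    exact ⟨fun _ => v, IsPolynomialMap.const v, fun c c' t hc => by simpa using hc v⟩
  | algebraMap r =>
    exact ⟨fun _ => 0, IsPolynomialMap.const 0, fun c c' t _ => by
      simpa using hasDerivAt_const t r⟩
  | add P Q _ _ hP hQ =>
    obtain ⟨x, hx, hxP⟩ := hP
    obtain ⟨y, hy, hyQ⟩ := hQ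
    refine ⟨fun ξ => x ξ + y ξ, fun l => ?_, fun c c' t hc => ?_⟩
    · simp only [map_add]
      exact add_mem (hx l) (hy l)
    · rw [map_add]
      exact (hxP c c' t hc).add (hyQ c c' t hc)
  | mul P Q hP' hQ' hP hQ =>
    obtain ⟨x, hx, hxP⟩ := hP
    obtain ⟨y, hy, hyQ⟩ := hQ
    refine ⟨fun ξ => Q ξ • x ξ + P ξ • y ξ, fun l => ?_, fun c c' t hc => ?_⟩
    · simp only [map_add, map_smul, smul_eq_mul]
      exact add_mem (mul_mem hQ' (hx l)) (mul_mem hP' (hy l))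
    · simp only [map_add, map_smul, smul_eq_mul]
      rw [mul_comm (Q _)]
      exact (hxP c c' t hc).mul (hyQ c c' t hc)

end PolynomialMaps

/-! ### Centralizers along the slice. -/

section Core

variable {g : Type*} [LieRing g] [LieAlgebra ℂ g]

lemma IsPrincipalTriple.isSl2Rep {h e f : g} (ht : IsPrincipalTriple h e f) :
    IsSl2Rep (LieAlgebra.ad ℂ g h) (LieAlgebra.ad ℂ g e) (LieAlgebra.ad ℂ g f) where
  e_f := LinearMap.ext fun z => by simp [← ht.lie_e_f]
  h_e := LinearMap.ext fun z => by simp [← lie_lie, ht.lie_h_e]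
  h_f := LinearMap.ext fun z => by simp [← lie_lie, ht.lie_h_f]

variable {κ : LinearMap.BilinForm ℂ g}

/-- The image of `ad x` is orthogonal to the centralizer of `x`; this underlies both the duality and
the transversality. -/
lemma form_lie_lie (hκ_inv : κ.lieInvariant g) {x y : g} (hxy : ⁅x, y⁆ = 0) (z : g) :
    κ ⁅x, z⁆ y = 0 := by
  rw [hκ_inv, hxy, map_zero, neg_zero]

variable [FiniteDimensional ℂ g] {h e f : g}

/-- The centralizers of `e` and `f` are in duality. -/
lemma eq_zero_of_form_ker_f (hκ_nondeg : κ.Nondegenerate) (hκ_inv : κ.lieInvariant g)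
    (ht : IsPrincipalTriple h e f) {a : g} (ha : ⁅e, a⁆ = 0)
    (hav : ∀ v, ⁅f, v⁆ = 0 → κ v a = 0) : a = 0 := by
  refine hκ_nondeg.2 a fun z => ?_
  obtain ⟨v, hv, _, ⟨b, rfl⟩, rfl⟩ := Submodule.mem_sup.mp
    (ht.isSl2Rep.symm.isCompl_ker_range.sup_eq_top ▸ Submodule.mem_top :
      z ∈ (LieAlgebra.ad ℂ g f).ker ⊔ (LieAlgebra.ad ℂ g e).range)
  rw [map_add, LinearMap.add_apply, hav v (by simpa using hv), LieAlgebra.ad_apply,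
    form_lie_lie hκ_inv ha, add_zero]

lemma eq_zero_of_form_ker_e (hκ_nondeg : κ.Nondegenerate) (hκ_inv : κ.lieInvariant g)
    (ht : IsPrincipalTriple h e f) {v : g} (hv : ⁅f, v⁆ = 0)
    (hav : ∀ a, ⁅e, a⁆ = 0 → κ a v = 0) : v = 0 := by
  refine hκ_nondeg.2 v fun z => ?_
  obtain ⟨a, ha, _, ⟨b, rfl⟩, rfl⟩ := Submodule.mem_sup.mp
    (ht.isSl2Rep.isCompl_ker_range.sup_eq_top ▸ Submodule.mem_top :
      z ∈ (LieAlgebra.ad ℂ g e).ker ⊔ (LieAlgebra.ad ℂ g f).range)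
  rw [map_add, LinearMap.add_apply, hav a (by simpa using ha), LieAlgebra.ad_apply,
    form_lie_lie hκ_inv hv, add_zero]

/-- The operator `∑ (-s ad u)^k`, the inverse of `1 + s ad u`. -/
def sliceInverse (s : End ℂ g) (n : ℕ) (u : g) : End ℂ g :=
  ∑ k ∈ Finset.range n, (-(s * LieAlgebra.ad ℂ g u)) ^ k

/-- The centralizers of the elements of the slice `e + 𝔷(f)` are parametrized by `𝔷(e)`. -/
lemma exists_sliceInverse (hκ_inv : κ.lieInvariant g) (ht : IsPrincipalTriple h e f) :
    ∃ (s : End ℂ g) (n : ℕ), ∀ u, ⁅f, u⁆ = 0 →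
      (∀ x, ⁅e + u, x⁆ = 0 → ∃ a, ⁅e, a⁆ = 0 ∧ x = sliceInverse s n u a) ∧
      ∀ a, ⁅e, a⁆ = 0 → ⁅e + u, sliceInverse s n u a⁆ = 0 ∧
        ∀ v, ⁅f, v⁆ = 0 → κ v (sliceInverse s n u a) = κ v a := by
  have t := ht.isSl2Rep
  obtain ⟨s, hsF, hs0, hsE, hsEE⟩ := t.exists_section
  obtain ⟨n, hn⟩ := t.symm.isNilpotent_e
  refine ⟨s, n, fun u hu => ?_⟩
  set N := s * LieAlgebra.ad ℂ g u with hN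
  have hcomm : Commute (LieAlgebra.ad ℂ g f) (LieAlgebra.ad ℂ g u) := by
    refine LinearMap.ext fun z => ?_
    simp only [Module.End.mul_apply, LieAlgebra.ad_apply]
    rw [leibniz_lie, hu, zero_lie, zero_add]
  have hNn : (-N) ^ n = 0 := by
    rw [neg_pow, t.section_mul_pow_eq_zero hs0 hsE hn hcomm, mul_zero]
  have h1 : (1 + N) * sliceInverse s n u = 1 := by
    have := mul_neg_geom_sum (-N) n
    rwa [hNn, sub_zero, sub_neg_eq_add] at this
  have h2 : sliceInverse s n u * (1 + N) = 1 := by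
    have := geom_sum_mul_neg (-N) n
    rwa [hNn, sub_zero, sub_neg_eq_add] at this
  -- Here `[u, x] = -[e, x]`, so `(1 + N) x = x - s (ad e x)`, which `ad e` kills.
  have hke : ∀ x ∈ (LieAlgebra.ad ℂ g (e + u)).ker, (1 + N) x ∈ (LieAlgebra.ad ℂ g e).ker := by
    intro x hx
    have hx' : ⁅u, x⁆ = -⁅e, x⁆ := by
      rw [eq_neg_iff_add_eq_zero, add_comm, ← add_lie]; exact hx
    have h3 : (1 + N) x = x - s (LieAlgebra.ad ℂ g e x) := by
      rw [hN, LinearMap.add_apply, Module.End.one_apply, Module.End.mul_apply, LieAlgebra.ad_apply,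
        LieAlgebra.ad_apply, hx', map_neg, sub_eq_add_neg]
    rw [LinearMap.mem_ker, h3, map_sub, hsEE, sub_self]
  have hinj : Function.Injective ((1 + N).restrict hke) := by
    intro x y hxy
    have := congrArg (fun z : (LieAlgebra.ad ℂ g e).ker => sliceInverse s n u z) hxy
    simp only [LinearMap.coe_restrict_apply, ← Module.End.mul_apply, h2] at this
    exact Subtype.ext this
  have hsurj : Function.Surjective ((1 + N).restrict hke) := by
    refine (LinearMap.injective_iff_surjective_of_finrank_eq_finrank ?_).mp hinj
    -- Regularity of `e` gives `dim 𝔷(e) ≤ dim 𝔷(e + u)`, so injectivity implies surjectivity.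
    exact le_antisymm (LinearMap.finrank_le_finrank_of_injective hinj) (ht.regular _)
  refine ⟨fun x hx => ⟨(1 + N) x, hke x hx, ?_⟩, fun a ha => ⟨?_, fun v hv => ?_⟩⟩
  · rw [← Module.End.mul_apply, h2, Module.End.one_apply]
  · obtain ⟨⟨x, hx⟩, hxa⟩ := hsurj ⟨a, ha⟩
    have hxa' : (1 + N) x = a := congrArg Subtype.val hxa
    rw [← hxa', ← Module.End.mul_apply, h2]
    exact hx
  -- The correction lies in the image of `s`, hence in `[f, g]`, which is orthogonal to `𝔷(f)`.
  · have h3 : a = sliceInverse s n u a + s ⁅u, sliceInverse s n u a⁆ := by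
      simpa [hN] using (LinearMap.congr_fun h1 a).symm
    obtain ⟨b, hb⟩ := hsF ⁅u, sliceInverse s n u a⁆
    conv_rhs => rw [h3]
    have h4 : κ v ⁅f, b⁆ = 0 := by
      rw [← neg_eq_zero, ← hκ_inv, hv, map_zero, LinearMap.zero_apply]
    rw [map_add, ← hb, LieAlgebra.ad_apply, h4, add_zero]

/-- The orbit of an element of the slice is transversal to the slice. -/
lemma eq_zero_of_lie_slice (hκ_nondeg : κ.Nondegenerate) (hκ_inv : κ.lieInvariant g)
    (hκ_symm : κ.IsSymm) (ht : IsPrincipalTriple h e f) {u z : g} (hu : ⁅f, u⁆ = 0)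
    (hz : ⁅f, ⁅e + u, z⁆⁆ = 0) : ⁅e + u, z⁆ = 0 := by
  obtain ⟨s, n, hsn⟩ := exists_sliceInverse hκ_inv ht
  refine eq_zero_of_form_ker_e hκ_nondeg hκ_inv ht hz fun a ha => ?_
  obtain ⟨h1, h2⟩ := (hsn u hu).2 a ha
  -- Against an element of `𝔷(f)`, `a` may be replaced by its transform in `𝔷(e + u)`, which is
  -- orthogonal to `[e + u, g]`.
  rw [hκ_symm.eq, ← h2 _ hz]
  exact form_lie_lie hκ_inv h1 z

end Core
-- The slice in the dual space.
section Slice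

variable {g : Type*} [LieRing g] [LieAlgebra ℂ g] {κ : LinearMap.BilinForm ℂ g} {e f : g}

lemma coadjoint_form (hκ_inv : κ.lieInvariant g) (x y : g) : ⁅x, κ y⁆ = κ ⁅x, y⁆ := by
  ext z
  rw [Module.Dual.lie_apply, hκ_inv]

lemma form_injective (hκ_nondeg : κ.Nondegenerate) : Function.Injective κ := by
  rw [← LinearMap.ker_eq_bot, Submodule.eq_bot_iff]
  exact fun x hx => hκ_nondeg.1 x fun y => by rw [LinearMap.mem_ker.mp hx, LinearMap.zero_apply]

lemma coadjoint_form_eq_zero_iff (hκ_nondeg : κ.Nondegenerate) (hκ_inv : κ.lieInvariant g)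
    {x y : g} : ⁅x, κ y⁆ = 0 ↔ ⁅y, x⁆ = 0 := by
  rw [coadjoint_form hκ_inv, map_eq_zero_iff κ (form_injective hκ_nondeg), ← lie_skew, neg_eq_zero]

lemma form_mem_kostantSlice (hκ_nondeg : κ.Nondegenerate) (u : g) :
    κ (e + u) ∈ kostantSlice κ e f ↔ ⁅f, u⁆ = 0 := by
  rw [kostantSlice, AffineSubspace.mem_mk', vsub_eq_sub, ← map_sub, add_sub_cancel_left,
    Submodule.mem_map]
  constructor
  · rintro ⟨v, hv, hvu⟩
    rw [← form_injective hκ_nondeg hvu]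
    exact hv
  · exact fun hu => ⟨u, hu, rfl⟩

lemma form_mem_direction {v : g} (hv : ⁅f, v⁆ = 0) : κ v ∈ (kostantSlice κ e f).direction := by
  rw [kostantSlice, AffineSubspace.direction_mk']
  exact ⟨v, hv, rfl⟩

lemma exists_of_mem_direction {η : Dual ℂ g} (hη : η ∈ (kostantSlice κ e f).direction) :
    ∃ v, ⁅f, v⁆ = 0 ∧ κ v = η := by
  rw [kostantSlice, AffineSubspace.direction_mk'] at hη
  exact hη

/-- The restriction of `x`, as a linear functional on `g^*`, to the direction of `S`. -/
def restrictDual (S : AffineSubspace ℂ (Dual ℂ g)) : g →ₗ[ℂ] Dual ℂ S.direction :=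
  Dual.transpose (R := ℂ) S.direction.subtype ∘ₗ Dual.eval ℂ g

lemma restrictDual_apply (S : AffineSubspace ℂ (Dual ℂ g)) (x : g) (v : S.direction) :
    restrictDual S x v = (v : Dual ℂ g) x := rfl

lemma restrictDual_kostantSlice_eq {x y : g} (h : ∀ v, ⁅f, v⁆ = 0 → κ v x = κ v y) :
    restrictDual (kostantSlice κ e f) x = restrictDual (kostantSlice κ e f) y := by
  ext ⟨_, hη⟩
  obtain ⟨v, hv, rfl⟩ := exists_of_mem_direction hη
  exact h v hv

variable [FiniteDimensional ℂ g] {h : g}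

lemma eq_zero_of_restrictDual_eq_zero (hκ_nondeg : κ.Nondegenerate) (hκ_inv : κ.lieInvariant g)
    (ht : IsPrincipalTriple h e f) {a : g} (ha : ⁅e, a⁆ = 0)
    (hr : restrictDual (kostantSlice κ e f) a = 0) : a = 0 :=
  eq_zero_of_form_ker_f hκ_nondeg hκ_inv ht ha fun v hv =>
    LinearMap.congr_fun hr ⟨κ v, form_mem_direction hv⟩

/-- Linear functionals on the direction of the Kostant slice are represented by elements of
`𝔷(e)`. -/
lemma exists_restrictDual_section (hκ_nondeg : κ.Nondegenerate) (hκ_inv : κ.lieInvariant g)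
    (ht : IsPrincipalTriple h e f) :
    ∃ A : Dual ℂ (kostantSlice κ e f).direction →ₗ[ℂ] g, (∀ α, ⁅e, A α⁆ = 0) ∧
      ∀ α, restrictDual (kostantSlice κ e f) (A α) = α := by
  let r := (restrictDual (kostantSlice κ e f)).domRestrict (LieAlgebra.ad ℂ g e).ker
  have hinj : Function.Injective r := by
    rw [← LinearMap.ker_eq_bot, Submodule.eq_bot_iff]
    rintro ⟨a, ha⟩ har
    exact Subtype.ext (eq_zero_of_restrictDual_eq_zero hκ_nondeg hκ_inv ht ha har)
  have hdim : finrank ℂ (LieAlgebra.ad ℂ g e).ker =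
      finrank ℂ (Dual ℂ (kostantSlice κ e f).direction) := by
    rw [Subspace.dual_finrank_eq, kostantSlice, AffineSubspace.direction_mk',
      finrank_map_of_disjoint_ker, ht.isSl2Rep.finrank_ker_eq]
    rw [LinearMap.ker_eq_bot.mpr (form_injective hκ_nondeg)]
    exact disjoint_bot_right
  obtain ⟨A, hA⟩ := LinearMap.exists_rightInverse_of_surjective r
    (LinearMap.range_eq_top.mpr
      ((LinearMap.injective_iff_surjective_of_finrank_eq_finrank hdim).mp hinj))
  exact ⟨(LieAlgebra.ad ℂ g e).ker.subtype ∘ₗ A, fun α => (A α).2, LinearMap.congr_fun hA⟩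

/-- The affine coordinate `U ξ = κ⁻¹ ξ - e` turns membership in the slice into `[f, U ξ] = 0`. -/
lemma exists_form_eq (hκ_nondeg : κ.Nondegenerate) (e : g) :
    ∃ U : Dual ℂ g → g, IsPolynomialMap U ∧ ∀ ξ, κ (e + U ξ) = ξ := by
  let K := κ.toDual hκ_nondeg
  refine ⟨fun ξ => K.symm ξ - e,
    (IsPolynomialMap.linearMap (K.symm : Dual ℂ g →ₗ[ℂ] g)).sub (IsPolynomialMap.const e),
    fun ξ => ?_⟩
  rw [add_sub_cancel]
  exact K.apply_symm_apply ξ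

/-- The length `n` of the geometric series is the same for all `u`; this is what makes `Φ⁻¹`
regular. -/
lemma isPolynomialMap_sliceInverse {V : Type*} [AddCommGroup V] [Module ℂ V] (s : End ℂ g) (n : ℕ)
    {U A : V → g} (hU : IsPolynomialMap U) (hA : IsPolynomialMap A) :
    IsPolynomialMap fun v => sliceInverse s n (U v) (A v) := by
  simp only [sliceInverse, LinearMap.sum_apply]
  refine IsPolynomialMap.sum _ fun k hk => ?_
  clear hk
  induction k with
  | zero => simpa using hA
  | succ k ih =>
    simp only [pow_succ', Module.End.mul_apply]
    exact IsPolynomialMap.bilinear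
      ((LinearMap.llcomp ℂ g g g (-s)) ∘ₗ (LieAlgebra.ad ℂ g : g →ₗ[ℂ] End ℂ g)) hU ih

end Slice

/-! ### Differentials of invariant polynomials. -/

section Invariants

variable {g : Type*} [LieRing g] [LieAlgebra ℂ g]

/-- The differential of an invariant function is annihilated by the coadjoint directions. -/
lemma apply_lie_eq_zero_of_invariant {P : Dual ℂ g → ℂ} (hP : IsInvariantPolynomial P)
    {ξ : Dual ℂ g} {x : g} (hx : ∀ (c : ℂ → Dual ℂ g) (c' : Dual ℂ g), c 0 = ξ →
      (∀ v : g, HasDerivAt (fun s => c s v) (c' v) 0) → HasDerivAt (fun s => P (c s)) (c' x) 0)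
    {n : g} (hn : n ∈ adNilpotentSpan g) : ξ ⁅n, x⁆ = 0 := by
  induction hn using Submodule.span_induction with
  | zero => simp
  | add u v _ _ hu hv => rw [add_lie, map_add, hu, hv, add_zero]
  | smul t u _ hu => rw [smul_lie, map_smul, hu, smul_zero]
  | mem n hn =>
    obtain ⟨k, hk⟩ := hn
    have hk2 : (LieAlgebra.ad ℂ g n) ^ (k + 2) = 0 := by rw [pow_add, hk, zero_mul]
    have ht (t : ℂ) : (LieAlgebra.ad ℂ g (t • n)) ^ (k + 2) = 0 := by
      rw [map_smul, smul_pow, hk2, smul_zero]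
    -- A polynomial curve in the coadjoint orbit of `ξ`, with velocity `ξ ∘ ad n` at `0`; `P` is
    -- constant on it.
    let c : ℂ → Dual ℂ g := fun t => ξ ∘ₗ nilpotentExp (LieAlgebra.ad ℂ g (t • n))
    have hc (t : ℂ) (v : g) : c t v = ∑ i ∈ Finset.range (k + 2),
        t ^ i * ((i.factorial : ℂ)⁻¹ * ξ (((LieAlgebra.ad ℂ g n) ^ i) v)) := by
      simp only [c, LinearMap.comp_apply]
      rw [nilpotentExp_eq_sum (ht t)]
      simp only [LinearMap.sum_apply, map_sum, LinearMap.smul_apply, map_smul, smul_pow,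
        smul_eq_mul]
      exact Finset.sum_congr rfl fun i _ => mul_left_comm _ _ _
    have hPc (t : ℂ) : P (c t) = P ξ := by
      obtain ⟨a, ha, hat⟩ := nilpotentExp_mem_adjointGroup (x := t • n) ⟨_, ht t⟩
      have := hP.2 a⁻¹ (inv_mem ha) ξ
      rwa [inv_inv, hat] at this
    have h1 := hx c (ξ ∘ₗ LieAlgebra.ad ℂ g n) ?_ fun v => ?_
    · simp only [hPc] at h1
      exact h1.unique (hasDerivAt_const 0 (P ξ))
    · ext v
      rw [hc, Finset.sum_range_succ']
      simp
    · simp only [hc]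
      have := HasDerivAt.fun_sum (u := Finset.range (k + 2)) fun i _ =>
        (hasDerivAt_pow i (0 : ℂ)).mul_const ((i.factorial : ℂ)⁻¹ * ξ (((LieAlgebra.ad ℂ g n) ^ i) v))
      refine this.congr_deriv ?_
      rw [Finset.sum_eq_single 1]
      · simp
      · intro i _ hi
        rcases i with _ | _ | i
        · simp
        · exact absurd rfl hi
        · simp
      · intro h
        simp at h

variable [FiniteDimensional ℂ g] {κ : LinearMap.BilinForm ℂ g} {h e f : g}

/-- The differential of an invariant function at a point of the slice centralizes this point. -/
lemma lie_eq_zero_of_invariant (hg : IsReductive g) (hκ_symm : κ.IsSymm)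
    (hκ_nondeg : κ.Nondegenerate) (hκ_inv : κ.lieInvariant g) (ht : IsPrincipalTriple h e f)
    {P : Dual ℂ g → ℂ} (hP : IsInvariantPolynomial P) {u x : g} (hu : ⁅f, u⁆ = 0)
    (hx : ∀ (c : ℂ → Dual ℂ g) (c' : Dual ℂ g), c 0 = κ (e + u) →
      (∀ v : g, HasDerivAt (fun s => c s v) (c' v) 0) → HasDerivAt (fun s => P (c s)) (c' x) 0) :
    ⁅e + u, x⁆ = 0 := by
  have hc : ⁅e + u, x⁆ ∈ LieAlgebra.center ℂ g := by
    refine mem_center_of_orthogonal hg κ hκ_nondeg hκ_inv fun n hn => ?_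
    have := apply_lie_eq_zero_of_invariant hP hx hn
    rw [← neg_eq_zero, ← hκ_inv, ← lie_skew, map_neg, LinearMap.neg_apply, neg_eq_zero, hκ_inv,
      neg_eq_zero]
    exact this
  -- A central element commutes with `f`, so transversality applies.
  exact eq_zero_of_lie_slice hκ_nondeg hκ_inv hκ_symm ht hu (hc f)

end Invariants

/-! ### Assembly of the isomorphism and of the section `dP`. -/

section Main

variable {g : Type*} [LieRing g] [LieAlgebra ℂ g] [FiniteDimensional ℂ g]
  {κ : LinearMap.BilinForm ℂ g} {h e f : g}

/-- The universal centralizer over the Kostant slice is isomorphic to the cotangent bundle of the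
slice. -/
lemma exists_equiv_cotangentBundle (hκ_nondeg : κ.Nondegenerate) (hκ_inv : κ.lieInvariant g)
    (ht : IsPrincipalTriple h e f) :
    ∃ Φ : universalCentralizer (kostantSlice κ e f) ≃ cotangentBundle (kostantSlice κ e f),
      IsRegularMap Φ.symm ∧
        ∀ z, (Φ z).1 = (z.1.2, restrictDual (kostantSlice κ e f) z.1.1) := by
  obtain ⟨U, hUpoly, hU⟩ := exists_form_eq hκ_nondeg e
  obtain ⟨A, hAe, hA⟩ := exists_restrictDual_section hκ_nondeg hκ_inv ht
  obtain ⟨s, n, hsn⟩ := exists_sliceInverse hκ_inv ht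
  have hUf : ∀ ξ ∈ kostantSlice κ e f, ⁅f, U ξ⁆ = 0 := fun ξ hξ =>
    (form_mem_kostantSlice hκ_nondeg (U ξ)).mp ((hU ξ).symm ▸ hξ)
  have hcent : ∀ (x : g) (ξ : Dual ℂ g), ⁅x, ξ⁆ = 0 ↔ ⁅e + U ξ, x⁆ = 0 := fun x ξ => by
    conv_lhs => rw [← hU ξ]
    exact coadjoint_form_eq_zero_iff hκ_nondeg hκ_inv
  have hmem : ∀ ξ ∈ kostantSlice κ e f, ∀ α, ⁅sliceInverse s n (U ξ) (A α), ξ⁆ = 0 :=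
    fun ξ hξ α => (hcent _ _).mpr ((hsn _ (hUf ξ hξ)).2 _ (hAe α)).1
  have hleft : ∀ ξ ∈ kostantSlice κ e f, ∀ x, ⁅x, ξ⁆ = 0 →
      sliceInverse s n (U ξ) (A (restrictDual (kostantSlice κ e f) x)) = x := by
    intro ξ hξ x hx
    obtain ⟨h1, h2⟩ := hsn _ (hUf ξ hξ)
    obtain ⟨a, ha, hxa⟩ := h1 x ((hcent x ξ).mp hx)
    have h3 : restrictDual (kostantSlice κ e f) x = restrictDual (kostantSlice κ e f) a :=
      restrictDual_kostantSlice_eq fun v hv => by rw [hxa, (h2 a ha).2 v hv]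
    -- Both elements lie in `𝔷(e)` and restrict to the same functional.
    have h4 : A (restrictDual (kostantSlice κ e f) x) - a = 0 := by
      refine eq_zero_of_restrictDual_eq_zero hκ_nondeg hκ_inv ht ?_ ?_
      · rw [lie_sub, hAe, ha, sub_zero]
      · rw [map_sub, hA, h3, sub_self]
    rw [sub_eq_zero.mp h4, ← hxa]
  have hright : ∀ ξ ∈ kostantSlice κ e f, ∀ α,
      restrictDual (kostantSlice κ e f) (sliceInverse s n (U ξ) (A α)) = α := fun ξ hξ α =>
    (restrictDual_kostantSlice_eq ((hsn _ (hUf ξ hξ)).2 _ (hAe α)).2).trans (hA α)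
  have hU' : IsPolynomialMap fun p : Dual ℂ g × Dual ℂ (kostantSlice κ e f).direction => U p.1 :=
    hUpoly.comp_linearMap (LinearMap.fst ℂ (Dual ℂ g) (Dual ℂ (kostantSlice κ e f).direction))
  have hA' : IsPolynomialMap fun p : Dual ℂ g × Dual ℂ (kostantSlice κ e f).direction => A p.2 :=
    IsPolynomialMap.linearMap
      (A ∘ₗ LinearMap.snd ℂ (Dual ℂ g) (Dual ℂ (kostantSlice κ e f).direction))
  have hpoly : IsPolynomialMap fun p : Dual ℂ g × Dual ℂ (kostantSlice κ e f).direction =>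
      (sliceInverse s n (U p.1) (A p.2), p.1) :=
    (isPolynomialMap_sliceInverse s n hU' hA').prodMk (IsPolynomialMap.linearMap
      (LinearMap.fst ℂ (Dual ℂ g) (Dual ℂ (kostantSlice κ e f).direction)))
  let Φ : universalCentralizer (kostantSlice κ e f) ≃ cotangentBundle (kostantSlice κ e f) :=
    { toFun := fun z => ⟨(z.1.2, restrictDual (kostantSlice κ e f) z.1.1), z.2.1⟩
      invFun := fun p => ⟨(sliceInverse s n (U p.1.1) (A p.1.2), p.1.1), p.2, hmem _ p.2 _⟩
      left_inv := fun z => Subtype.ext (Prod.ext (hleft _ z.2.1 _ z.2.2) rfl)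
      right_inv := fun p => Subtype.ext (Prod.ext rfl (hright _ p.2 _)) }
  have h1 : ∀ p, (Φ.symm p).1 = (sliceInverse s n (U p.1.1) (A p.1.2), p.1.1) := fun p => rfl
  have h2 : ∀ z, (Φ z).1 = (z.1.2, restrictDual (kostantSlice κ e f) z.1.1) := fun z => rfl
  exact ⟨Φ, hpoly.isRegularMap h1, h2⟩

/-- The differential of an invariant polynomial is a regular section of the universal
centralizer. -/
lemma exists_differential_section (hg : IsReductive g) (hκ_symm : κ.IsSymm)
    (hκ_nondeg : κ.Nondegenerate) (hκ_inv : κ.lieInvariant g) (ht : IsPrincipalTriple h e f)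
    {P : Dual ℂ g → ℂ} (hP : IsInvariantPolynomial P) :
    ∃ x : Dual ℂ g → g, IsPolynomialMap x ∧ (∀ ξ ∈ kostantSlice κ e f, ⁅x ξ, ξ⁆ = 0) ∧
      ∀ ξ, IsDifferentialAt P ξ (x ξ) := by
  obtain ⟨U, -, hU⟩ := exists_form_eq hκ_nondeg e
  obtain ⟨x, hxpoly, hx⟩ := exists_differential hP.1
  refine ⟨x, hxpoly, fun ξ hξ => ?_, fun ξ η => ?_⟩
  · rw [← hU ξ, form_mem_kostantSlice hκ_nondeg] at hξ
    rw [← hU ξ]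
    refine (coadjoint_form_eq_zero_iff hκ_nondeg hκ_inv).mpr
      (lie_eq_zero_of_invariant hg hκ_symm hκ_nondeg hκ_inv ht hP hξ fun c c' hc hcc => ?_)
    rw [← hc]
    exact hx c c' 0 hcc
  · have := hx (fun t => ξ + t • η) η 0 fun v => ?_
    · simpa [HasLineDerivAt] using this
    · simpa using ((hasDerivAt_id (0 : ℂ)).mul_const (η v)).const_add (ξ v)

end Main

end KostantSlice

theorem mainTheorem7 {g : Type*} [LieRing g] [LieAlgebra ℂ g] [FiniteDimensional ℂ g]
    (hg : IsReductive g)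
    (κ : LinearMap.BilinForm ℂ g) (hκ_symm : κ.IsSymm) (hκ_nondeg : κ.Nondegenerate)
    (hκ_inv : κ.lieInvariant g)
    {h e f : g} (ht : IsPrincipalTriple h e f) :
    ∃ Φ : universalCentralizer (kostantSlice κ e f) ≃
        cotangentBundle (kostantSlice κ e f),
      -- `Φ` is an isomorphism of algebraic varieties
      IsRegularMap Φ ∧ IsRegularMap Φ.symm ∧
      -- over `Σ`
      (∀ z, (Φ z).1.1 = z.1.2) ∧
      -- which is linear on the fibres
      (∀ z₁ z₂ z₃, z₁.1.2 = z₂.1.2 → z₁.1.2 = z₃.1.2 → ∀ a b : ℂ,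
        z₃.1.1 = a • z₁.1.1 + b • z₂.1.1 → (Φ z₃).1.2 = a • (Φ z₁).1.2 + b • (Φ z₂).1.2) ∧
      -- and is the canonical one: `x ∈ 𝔷(ξ) ⊆ g = (g^*)^*` is restricted to `T_ξ Σ ⊆ g^*`
      (∀ z, ∀ v : (kostantSlice κ e f).direction,
        (Φ z).1.2 v = (v : Dual ℂ g) z.1.1) ∧
      -- the differential `dP` of an invariant `P` is a regular section of the
      -- universal centralizer, and corresponds to the section `d(P|_Σ)` of `T^*Σ`
      (∀ P : Dual ℂ g → ℂ, IsInvariantPolynomial P →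
        ∃ σ : ↥(kostantSlice κ e f : Set (Dual ℂ g)) →
            universalCentralizer (kostantSlice κ e f),
          IsRegularMap σ ∧
          ∀ ξ, (σ ξ).1.2 = ξ ∧
            IsDifferentialAt P ξ (σ ξ).1.1 ∧
            HasDifferentialAt (kostantSlice κ e f)
              (fun η => P (η : Dual ℂ g)) ξ (Φ (σ ξ)).1.2) := by
  obtain ⟨Φ, hΦsymm, hΦ⟩ := exists_equiv_cotangentBundle hκ_nondeg hκ_inv ht
  have hΦ1 : ∀ z, (Φ z).1.1 = z.1.2 := fun z => congrArg Prod.fst (hΦ z)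
  have hΦ2 : ∀ z, (Φ z).1.2 = restrictDual (kostantSlice κ e f) z.1.1 :=
    fun z => congrArg Prod.snd (hΦ z)
  refine ⟨Φ, ?_, hΦsymm, hΦ1, ?_, fun z v => by rw [hΦ2]; rfl, ?_⟩
  · exact (IsPolynomialMap.linearMap ((LinearMap.snd ℂ g (Dual ℂ g)).prod
      (restrictDual (kostantSlice κ e f) ∘ₗ LinearMap.fst ℂ g (Dual ℂ g)))).isRegularMap hΦ
  · intro z₁ z₂ z₃ _ _ a b hz
    rw [hΦ2, hΦ2, hΦ2, hz, map_add, map_smul, map_smul]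
  · intro P hP
    obtain ⟨x, hxpoly, hxc, hx⟩ :=
      exists_differential_section hg hκ_symm hκ_nondeg hκ_inv ht hP
    refine ⟨fun ξ => ⟨(x ξ, ξ), ξ.2, hxc ξ ξ.2⟩,
      (hxpoly.prodMk (IsPolynomialMap.linearMap LinearMap.id)).isRegularMap fun ξ => rfl,
      fun ξ => ⟨rfl, hx ξ, fun v => ?_⟩⟩
    rw [hΦ2, restrictDual_apply]
    have := hx ξ v
    -- The derivative of `P` along a tangent line of the slice is already that of `P|_Σ`; only the
    -- order of the summands differs.
    simp only [HasLineDerivAt, add_comm (ξ : Dual ℂ g)] at this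
    exact this
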